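/- Let $G$ be a torsion-free hyperbolic group which is co-hopfian (every injective endomorphism of $G$ is an automorphism), and let $A$ be a finite generating set of $G$. Here a finitely generated group is hyperbolic if, for some finite generating set, the geometric realization of its Cayley graph (with edges of length $1$) is $\delta$-hyperbolic for some $\delta \ge 0$, i.e. in every geodesic triangle each side lies in the closed $\delta$-neighbourhood of the union of the other two sides. Let $d_A$ be the distance on $G$ in the Cayley graph with respect to $A \cup A^{-1}$, and for $p,g,h\in G$ let $$(g|h)_p^A = \tfrac12\bigl(d_A(p,g)+d_A(p,h)-d_A(g,h)\bigr)$$ be the Gromov product. Let $p\in G$, $\gamma>0$, $T\ge 1$, and let $d$ be a metric on $G$ (a visual metric) such that $$\tfrac1T e^{-\gamma (g|h)_p^A}\le d(g,h)\le T e^{-\gamma (g|h)_p^A}\qquad\text{for all distinct } g,h\in G.$$ Let $(\widehat G,\widehat d)$ be the completion of $(G,d)$. A map $f$ between metric spaces $(X,d_X)$ and $(Y,d_Y)$ satisfies a Hölder condition if there are constants $r>0$, $K>0$ with $d_Y(f(x),f(y))\le K\,d_X(x,y)^r$ for all $x,y \in X$. Let $\varphi:G\to G$ be a nontrivial endomorphism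 (that is, $\varphi(g)\ne 1$ for some $g$). Then the following conditions are equivalent: 1. $\varphi$ is uniformly continuous with respect to $d$; 2. $\varphi$ satisfies a Hölder condition with respect to $d$; 3. $\varphi$ admits a continuous extension to the completion $(\widehat G,\widehat d)$, i.e. there is a continuous map $\Phi:\widehat G\to\widehat G$ with $\Phi|_G=\varphi$; 4. $\varphi$ admits an extension $\Phi:\widehat G\to\widehat G$ satisfying a Hölder condition with respect to $\widehat d$; 5. there exist constants $P>0$ and $Q\in\mathbb R$ such that $P\,(\varphi(g)|\varphi(h))_p^A+Q\ge (g|h)_p^A$ for all $g,h\in G$; 6. $\varphi$ is a quasi-isometric embedding of $(G,d_A)$ into itself, i.e. there are constants $\lambda\ge1$, $K\ge0$ with $\frac1\lambda d_A(g,h)-K\le d_A(\varphi(g),\varphi(h))\le\lambda d_A(g,h)+K$ for all $g,h\in G$; 7. $\varphi$ is virtually injective, i.e. $\ker\varphi$ is finite; 8. $\varphi$ is an automorphism of $G$. -/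

import Mathlib

open scoped NNReal

/-! ## Geometric realization of a connected graph -/

/-- The geometric realization of a graph, in barycentric coordinates: a point is a formal convex
combination of vertices whose support is contained in a single vertex or a single edge. -/
@[ext]
structure SimpleGraph.Realization {V : Type*} (Γ : SimpleGraph V) where
  coord : V →₀ ℝ
  nonneg : ∀ x, 0 ≤ coord x
  sum_eq : (coord.sum fun _ t => t) = 1
  edge : ∃ x y, (x = y ∨ Γ.Adj x y) ∧ (coord.support : Set V) ⊆ {x, y}

namespace SimpleGraph.Realization

variable {V : Type*} {Γ : SimpleGraph V}

/-- `r` is the length of a path of the realization (every edge having length one) from `p` to `q`,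
which either stays inside one edge `{x, y}` containing both points, or leaves along the edge
of `p` to a vertex `x`, follows a shortest edge path to a vertex `y`, and reaches `q` along
the edge of `q`. A shortest path is always of one of these two kinds. -/
def IsRouteLength (p q : Γ.Realization) (r : ℝ) : Prop :=
  (∃ x y, Γ.Adj x y ∧ (p.coord.support : Set V) ⊆ {x, y} ∧ (q.coord.support : Set V) ⊆ {x, y} ∧
    r = |p.coord x - q.coord x|) ∨
  (∃ x ∈ p.coord.support, ∃ y ∈ q.coord.support,
    r = (1 - p.coord x) + (Γ.dist x y : ℝ) + (1 - q.coord y))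

/-- The length of a shortest path between two points of the realization. -/
noncomputable def pathDist (p q : Γ.Realization) : ℝ := sInf {r | IsRouteLength p q r}

/-- A vertex of the graph, as a point of the realization. -/
noncomputable def vertex (Γ : SimpleGraph V) (x : V) : Γ.Realization where
  coord := Finsupp.single x 1
  nonneg := fun y => by
    classical
    rw [Finsupp.single_apply]
    split_ifs <;> norm_num
  sum_eq := by simp
  edge := ⟨x, x, Or.inl rfl, by
    intro z hz
    have := Finsupp.support_single_subset hz
    simpa using this⟩

lemma coord_le_one (p : Γ.Realization) (x : V) : p.coord x ≤ 1 := by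
  by_cases hx : x ∈ p.coord.support
  · rw [← p.sum_eq]
    exact Finset.single_le_sum (f := fun z => p.coord z) (fun z _ => p.nonneg z) hx
  · rw [Finsupp.notMem_support_iff.1 hx]
    norm_num

lemma coord_add (p : Γ.Realization) {x y : V} (hxy : x ≠ y)
    (h : (p.coord.support : Set V) ⊆ {x, y}) : p.coord x + p.coord y = 1 := by
  classical
  have hs : p.coord.support ⊆ {x, y} := by
    intro z hz
    simpa using h hz
  have := Finsupp.sum_of_support_subset p.coord hs (fun _ t => t) (fun _ _ => rfl)
  rw [p.sum_eq, Finset.sum_pair hxy] at this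
  exact this.symm

lemma exists_mem_support (p : Γ.Realization) : ∃ x, x ∈ p.coord.support := by
  by_contra! h
  have h0 : p.coord.support = ∅ := Finset.eq_empty_of_forall_notMem h
  have := p.sum_eq
  rw [Finsupp.sum, h0] at this
  simp at this

lemma dist_le_of_mem (p : Γ.Realization) {x y : V} (hx : x ∈ p.coord.support)
    (hy : y ∈ p.coord.support) :
    (Γ.dist x y : ℝ) ≤ (1 - p.coord x) + (1 - p.coord y) := by
  by_cases hxy : x = y
  · subst hxy
    have := p.coord_le_one x
    simp only [SimpleGraph.dist_self, Nat.cast_zero]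
    linarith
  · obtain ⟨u, v, huv, hs⟩ := p.edge
    have hxs : x = u ∨ x = v := by simpa using hs hx
    have hys : y = u ∨ y = v := by simpa using hs hy
    have key : Γ.Adj x y ∧ (p.coord.support : Set V) ⊆ {x, y} := by
      rcases hxs with rfl | rfl <;> rcases hys with rfl | rfl
      · exact absurd rfl hxy
      · exact ⟨huv.resolve_left hxy, hs⟩
      · exact ⟨(huv.resolve_left (Ne.symm hxy)).symm, by rwa [Set.pair_comm]⟩
      · exact absurd rfl hxy
    have h1 := SimpleGraph.dist_eq_one_iff_adj.2 key.1
    have h2 := p.coord_add hxy key.2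
    rw [h1]
    push_cast
    linarith

lemma abs_sub_eq (p q : Γ.Realization) {x y : V} (hxy : x ≠ y)
    (hp : (p.coord.support : Set V) ⊆ {x, y}) (hq : (q.coord.support : Set V) ⊆ {x, y}) :
    |p.coord x - q.coord x| = |p.coord y - q.coord y| := by
  have h1 := p.coord_add hxy hp
  have h2 := q.coord_add hxy hq
  have h3 : p.coord x - q.coord x = -(p.coord y - q.coord y) := by linarith
  rw [h3, abs_neg]

lemma IsRouteLength.nonneg {p q : Γ.Realization} {r : ℝ} (h : IsRouteLength p q r) : 0 ≤ r := by
  rcases h with ⟨x, y, -, -, -, rfl⟩ | ⟨x, -, y, -, rfl⟩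
  · exact abs_nonneg _
  · have h1 := p.coord_le_one x
    have h2 := q.coord_le_one y
    have h3 : (0 : ℝ) ≤ Γ.dist x y := Nat.cast_nonneg _
    linarith

lemma IsRouteLength.symm {p q : Γ.Realization} {r : ℝ} (h : IsRouteLength p q r) :
    IsRouteLength q p r := by
  rcases h with ⟨x, y, ha, hp, hq, rfl⟩ | ⟨x, hx, y, hy, rfl⟩
  · exact Or.inl ⟨x, y, ha, hq, hp, abs_sub_comm _ _⟩
  · refine Or.inr ⟨y, hy, x, hx, ?_⟩
    rw [SimpleGraph.dist_comm]
    ring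

lemma exists_isRouteLength (p q : Γ.Realization) : {r | IsRouteLength p q r}.Nonempty := by
  obtain ⟨x, hx⟩ := p.exists_mem_support
  obtain ⟨y, hy⟩ := q.exists_mem_support
  exact ⟨_, Or.inr ⟨x, hx, y, hy, rfl⟩⟩

lemma finite_isRouteLength (p q : Γ.Realization) : {r | IsRouteLength p q r}.Finite := by
  have h1 : ((fun x => |p.coord x - q.coord x|) '' (p.coord.support : Set V)).Finite :=
    (Finset.finite_toSet _).image _
  have h2 : ((fun z : V × V => (1 - p.coord z.1) + (Γ.dist z.1 z.2 : ℝ) + (1 - q.coord z.2)) ''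
      ((p.coord.support : Set V) ×ˢ (q.coord.support : Set V))).Finite :=
    ((Finset.finite_toSet _).prod (Finset.finite_toSet _)).image _
  refine (h1.union h2).subset ?_
  rintro r (⟨x, y, ha, hp, hq, rfl⟩ | ⟨x, hx, y, hy, rfl⟩)
  · left
    obtain ⟨z, hz⟩ := p.exists_mem_support
    have hz' : z = x ∨ z = y := by simpa using hp hz
    refine ⟨z, hz, ?_⟩
    rcases hz' with rfl | rfl
    · rfl
    · exact (abs_sub_eq p q ha.ne hp hq).symm
  · right
    exact ⟨(x, y), ⟨hx, hy⟩, rfl⟩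

lemma isRouteLength_pathDist (p q : Γ.Realization) : IsRouteLength p q (pathDist p q) :=
  (exists_isRouteLength p q).csInf_mem (finite_isRouteLength p q)

lemma pathDist_le {p q : Γ.Realization} {r : ℝ} (h : IsRouteLength p q r) : pathDist p q ≤ r :=
  csInf_le ⟨0, fun _ hs => hs.nonneg⟩ h

lemma pathDist_nonneg (p q : Γ.Realization) : 0 ≤ pathDist p q :=
  (isRouteLength_pathDist p q).nonneg

lemma pathDist_comm (p q : Γ.Realization) : pathDist p q = pathDist q p :=
  le_antisymm (pathDist_le (isRouteLength_pathDist q p).symm)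
    (pathDist_le (isRouteLength_pathDist p q).symm)

lemma pathDist_self (p : Γ.Realization) : pathDist p p = 0 := by
  refine le_antisymm (pathDist_le ?_) (pathDist_nonneg p p)
  obtain ⟨x, y, hxy, hs⟩ := p.edge
  rcases hxy with rfl | hxy
  · right
    obtain ⟨z, hz⟩ := p.exists_mem_support
    have hs' : p.coord.support ⊆ {z} := by
      intro w hw
      have h1 : w = x := by simpa using hs hw
      have h2 : z = x := by simpa using hs hz
      simp [h1, h2]
    have := Finsupp.sum_of_support_subset p.coord hs' (fun _ t => t) (fun _ _ => rfl)
    rw [p.sum_eq, Finset.sum_singleton] at this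
    refine ⟨z, hz, z, hz, ?_⟩
    simp [← this]
  · exact Or.inl ⟨x, y, hxy, hs, hs, by simp⟩

lemma eq_of_pathDist_eq_zero (hΓ : Γ.Connected) {p q : Γ.Realization} (h : pathDist p q = 0) :
    p = q := by
  have key : ∀ (p : Γ.Realization) (x z : V), p.coord x = 1 → z ≠ x → p.coord z = 0 := by
    intro p x z hx hz
    by_contra h0
    have hxm : x ∈ p.coord.support := by simp [hx]
    have hzm : z ∈ p.coord.support := by simp [h0]
    have h1 := p.dist_le_of_mem hxm hzm
    have h2 : 0 < p.coord z := lt_of_le_of_ne (p.nonneg z) (Ne.symm h0)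
    have h3 : 1 ≤ Γ.dist x z := hΓ.pos_dist_of_ne (Ne.symm hz)
    have h4 : (1 : ℝ) ≤ Γ.dist x z := by exact_mod_cast h3
    linarith
  rcases h ▸ isRouteLength_pathDist p q with ⟨x, y, ha, hp, hq, hr⟩ | ⟨x, hx, y, hy, hr⟩
  · have h1 : p.coord x = q.coord x := by
      have := abs_eq_zero.1 hr.symm
      linarith
    have h2 := p.coord_add ha.ne hp
    have h3 := q.coord_add ha.ne hq
    ext z
    by_cases hz : z = x
    · rw [hz, h1]
    · by_cases hz' : z = y
      · rw [hz']; linarith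
      · have hn : ∀ (p : Γ.Realization), (p.coord.support : Set V) ⊆ {x, y} → p.coord z = 0 := by
          intro p hp
          by_contra h0
          have : z = x ∨ z = y := by simpa using hp (by simpa using h0 : z ∈ p.coord.support)
          tauto
        rw [hn p hp, hn q hq]
  · have h1 := p.coord_le_one x
    have h2 := q.coord_le_one y
    have h3 : (0 : ℝ) ≤ Γ.dist x y := Nat.cast_nonneg _
    have h4 : (Γ.dist x y : ℝ) = 0 := by linarith
    have h5 : x = y := hΓ.dist_eq_zero_iff.1 (by exact_mod_cast h4)
    subst h5
    have h6 : p.coord x = 1 := by linarith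
    have h7 : q.coord x = 1 := by linarith
    ext z
    by_cases hz : z = x
    · rw [hz, h6, h7]
    · rw [key p x z h6 hz, key q x z h7 hz]

/-- A route inside an edge can be replaced by one through vertices if it ends at a vertex. -/
lemma via_of_vertex {p q : Γ.Realization} {x y : V} (ha : Γ.Adj x y)
    (hp : (p.coord.support : Set V) ⊆ {x, y}) (hq : (q.coord.support : Set V) ⊆ {x, y})
    (hx : q.coord x = 0) :
    ∃ u ∈ p.coord.support, ∃ v ∈ q.coord.support,
      |p.coord x - q.coord x| = (1 - p.coord u) + (Γ.dist u v : ℝ) + (1 - q.coord v) := by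
  have h1 := p.coord_add ha.ne hp
  have h2 := q.coord_add ha.ne hq
  have h3 := p.nonneg x
  have hy : q.coord y = 1 := by linarith
  have hym : y ∈ q.coord.support := by simp [hy]
  by_cases h0 : p.coord y = 0
  · have h4 : p.coord x = 1 := by linarith
    refine ⟨x, by simp [h4], y, hym, ?_⟩
    rw [SimpleGraph.dist_eq_one_iff_adj.2 ha, hx, hy, h4]
    norm_num
  · refine ⟨y, by simp [h0], y, hym, ?_⟩
    rw [hx, hy, SimpleGraph.dist_self, sub_zero, abs_of_nonneg h3]
    push_cast
    linarith

lemma route_via_direct (hΓ : Γ.Connected) {p q s : Γ.Realization} {x y a b : V}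
    (hx : x ∈ p.coord.support) (hy : y ∈ q.coord.support) (ha : Γ.Adj a b)
    (hq : (q.coord.support : Set V) ⊆ {a, b}) (hs : (s.coord.support : Set V) ⊆ {a, b}) :
    ∃ r, IsRouteLength p s r ∧ r ≤ (1 - p.coord x) + (Γ.dist x y : ℝ) + (1 - q.coord y) +
      |q.coord a - s.coord a| := by
  have hy' : y = a ∨ y = b := by simpa using hq hy
  wlog hya : y = a generalizing a b
  · obtain ⟨r, hr, hle⟩ := this ha.symm (by rwa [Set.pair_comm]) (by rwa [Set.pair_comm])
      hy'.symm (hy'.resolve_left hya)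
    exact ⟨r, hr, by rwa [abs_sub_eq q s ha.ne hq hs]⟩
  subst hya
  by_cases h0 : s.coord y = 0
  · have hb : s.coord b = 1 := by
      have := s.coord_add ha.ne hs
      linarith
    refine ⟨_, Or.inr ⟨x, hx, b, by simp [hb], rfl⟩, ?_⟩
    have h1 : Γ.dist x b ≤ Γ.dist x y + Γ.dist y b := hΓ.dist_triangle
    rw [SimpleGraph.dist_eq_one_iff_adj.2 ha] at h1
    have h2 : (Γ.dist x b : ℝ) ≤ Γ.dist x y + 1 := by exact_mod_cast h1
    rw [h0, hb, sub_zero, abs_of_nonneg (q.nonneg y)]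
    linarith
  · refine ⟨_, Or.inr ⟨x, hx, y, by simp [h0], rfl⟩, ?_⟩
    have := le_abs_self (q.coord y - s.coord y)
    linarith

lemma route_trans (hΓ : Γ.Connected) {p q s : Γ.Realization} {r₁ r₂ : ℝ}
    (h₁ : IsRouteLength p q r₁) (h₂ : IsRouteLength q s r₂) :
    ∃ r, IsRouteLength p s r ∧ r ≤ r₁ + r₂ := by
  rcases h₁ with ⟨x, y, ha, hp, hq, rfl⟩ | ⟨x, hx, y, hy, rfl⟩
  · rcases h₂ with ⟨a, b, hb, hq', hs, rfl⟩ | ⟨u, hu, v, hv, rfl⟩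
    · by_cases hqx : q.coord x = 0
      · obtain ⟨u, hu, v, hv, he⟩ := via_of_vertex ha hp hq hqx
        rw [he]
        exact route_via_direct hΓ hu hv hb hq' hs
      · by_cases hqy : q.coord y = 0
        · obtain ⟨u, hu, v, hv, he⟩ := via_of_vertex (p := p) (q := q) ha.symm
            (by rwa [Set.pair_comm])
            (by rwa [Set.pair_comm]) hqy
          rw [abs_sub_eq p q ha.ne hp hq, he]
          exact route_via_direct hΓ hu hv hb hq' hs
        · have h1 : x = a ∨ x = b := by
            simpa using hq' (by simpa using hqx : x ∈ q.coord.support)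
          have h2 : y = a ∨ y = b := by
            simpa using hq' (by simpa using hqy : y ∈ q.coord.support)
          have h3 : (s.coord.support : Set V) ⊆ {x, y} ∧
              |q.coord a - s.coord a| = |q.coord x - s.coord x| := by
            rcases h1 with rfl | rfl <;> rcases h2 with rfl | rfl
            · exact absurd rfl ha.ne
            · exact ⟨hs, rfl⟩
            · exact ⟨by rwa [Set.pair_comm], abs_sub_eq q s hb.ne hq' hs⟩
            · exact absurd rfl ha.ne
          refine ⟨_, Or.inl ⟨x, y, ha, hp, h3.1, rfl⟩, ?_⟩
          rw [h3.2]
          exact abs_sub_le _ _ _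
    · obtain ⟨r, hr, hle⟩ := route_via_direct (p := s) hΓ hv hu ha hq hp
      refine ⟨r, hr.symm, hle.trans (le_of_eq ?_)⟩
      rw [abs_sub_comm, SimpleGraph.dist_comm]
      ring
  · rcases h₂ with ⟨a, b, hb, hq', hs, rfl⟩ | ⟨u, hu, v, hv, rfl⟩
    · exact route_via_direct hΓ hx hy hb hq' hs
    · refine ⟨_, Or.inr ⟨x, hx, v, hv, rfl⟩, ?_⟩
      have h1 := q.dist_le_of_mem hy hu
      have h2 : Γ.dist x v ≤ Γ.dist x y + Γ.dist y v := hΓ.dist_triangle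
      have h3 : Γ.dist y v ≤ Γ.dist y u + Γ.dist u v := hΓ.dist_triangle
      have h4 : (Γ.dist x v : ℝ) ≤ Γ.dist x y + (Γ.dist y u + Γ.dist u v) := by
        exact_mod_cast h2.trans (Nat.add_le_add_left h3 _)
      linarith

/-- The realization of a connected graph, with its path metric. -/
noncomputable abbrev metricSpace (hΓ : Γ.Connected) : MetricSpace Γ.Realization where
  dist := pathDist
  dist_self := pathDist_self
  dist_comm := pathDist_comm
  dist_triangle p q s := by
    obtain ⟨r, hr, hle⟩ :=
      route_trans hΓ (isRouteLength_pathDist p q) (isRouteLength_pathDist q s)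
    exact (pathDist_le hr).trans hle
  eq_of_dist_eq_zero := eq_of_pathDist_eq_zero hΓ

/-- The graph embeds isometrically into its realization. -/
lemma pathDist_vertex (x y : V) :
    pathDist (vertex Γ x) (vertex Γ y) = Γ.dist x y := by
  have hsupp : ∀ z, (vertex Γ z).coord.support = {z} := fun z =>
    Finsupp.support_single z one_ne_zero
  have hone : ∀ z, (vertex Γ z).coord z = 1 := fun z => Finsupp.single_eq_same
  refine le_antisymm (pathDist_le (Or.inr ⟨x, by simp [hsupp], y, by simp [hsupp], ?_⟩)) ?_
  · simp [hone]
  · rcases isRouteLength_pathDist (vertex Γ x) (vertex Γ y) with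
      ⟨a, b, ha, hp, hq, hr⟩ | ⟨u, hu, v, hv, hr⟩
    · rw [hr]
      have hxa : x = a ∨ x = b := by simpa [hsupp] using hp
      have hya : y = a ∨ y = b := by simpa [hsupp] using hq
      by_cases hxy : x = y
      · subst hxy
        simp
      · have hadj : Γ.Adj x y ∧ (a = x ∨ a = y) := by
          rcases hxa with rfl | rfl <;> rcases hya with rfl | rfl
          · exact absurd rfl hxy
          · exact ⟨ha, Or.inl rfl⟩
          · exact ⟨ha.symm, Or.inr rfl⟩
          · exact absurd rfl hxy
        rw [SimpleGraph.dist_eq_one_iff_adj.2 hadj.1]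
        have h0 : ∀ z w : V, z ≠ w → (vertex Γ z).coord w = 0 := fun z w h =>
          Finsupp.single_eq_of_ne (Ne.symm h)
        rcases hadj.2 with rfl | rfl
        · rw [hone, h0 y _ (Ne.symm hxy)]; norm_num
        · rw [hone, h0 x _ hxy]; norm_num
    · rw [hsupp, Finset.mem_singleton] at hu hv
      subst hu hv
      rw [hr, hone, hone]
      simp

end SimpleGraph.Realization

/-! ## Hyperbolic spaces -/

/-- `S` is (the image of) a geodesic from `x` to `y`: an isometric embedding `ξ` of a real interval
`[0, s]` with `ξ 0 = x` and `ξ s = y`. -/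
def IsGeodesicSegment {X : Type*} [MetricSpace X] (x y : X) (S : Set X) : Prop :=
  ∃ (s : ℝ) (ξ : ℝ → X), 0 ≤ s ∧ ξ 0 = x ∧ ξ s = y ∧
    (∀ u ∈ Set.Icc 0 s, ∀ v ∈ Set.Icc 0 s, dist (ξ u) (ξ v) = |u - v|) ∧ S = ξ '' Set.Icc 0 s

/-- The Rips condition: geodesic triangles are `δ`-thin. -/
def IsDeltaHyperbolic (X : Type*) [MetricSpace X] (δ : ℝ) : Prop :=
  ∀ (x₀ x₁ x₂ : X) (S₀₁ S₁₂ S₀₂ : Set X), IsGeodesicSegment x₀ x₁ S₀₁ →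
    IsGeodesicSegment x₁ x₂ S₁₂ → IsGeodesicSegment x₀ x₂ S₀₂ →
    ∀ y ∈ S₀₂, Metric.infDist y (S₀₁ ∪ S₁₂) ≤ δ

/-! ## Cayley graphs, hyperbolic groups, visual metrics -/

section Groups

variable {G : Type*} [Group G]

/-- The Cayley graph `SimpleGraph.mulCayley A` (edges `g — ga` for `a ∈ A ∪ A⁻¹`, without loops)
of a generating set is connected. -/
lemma mulCayley_connected {A : Set G} (hA : Subgroup.closure A = ⊤) :
    (SimpleGraph.mulCayley A).Connected := by
  have step : ∀ g a, a ∈ A → (SimpleGraph.mulCayley A).Reachable g (g * a) := by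
    intro g a ha
    by_cases h : g = g * a
    · rw [← h]
    · exact SimpleGraph.Adj.reachable ((SimpleGraph.mulCayley_adj A _ _).2 ⟨h, Or.inl (by simpa)⟩)
  have h1 : ∀ g ∈ Subgroup.closure A, ∀ x, (SimpleGraph.mulCayley A).Reachable x (x * g) := by
    intro g hg
    induction hg using Subgroup.closure_induction with
    | mem a ha => exact fun x => step x a ha
    | one => intro x; rw [mul_one]
    | mul a b _ _ iha ihb =>
      intro x
      have := (iha x).trans (ihb (x * a))
      rwa [mul_assoc] at this
    | inv a _ iha =>
      intro x
      have := (iha (x * a⁻¹)).symm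
      rwa [inv_mul_cancel_right] at this
  have : Nonempty G := ⟨1⟩
  refine SimpleGraph.Connected.mk fun g h => ?_
  have := h1 (g⁻¹ * h) (by rw [hA]; trivial) g
  rwa [mul_inv_cancel_left] at this

/-- A group is hyperbolic if it has a finite generating set for which the geometric realization
of the Cayley graph is a hyperbolic metric space. -/
def IsHyperbolicGroup (G : Type*) [Group G] : Prop :=
  ∃ (A : Set G) (_ : A.Finite) (hA : Subgroup.closure A = ⊤),
    letI := SimpleGraph.Realization.metricSpace (mulCayley_connected hA)
    ∃ δ : ℝ, 0 ≤ δ ∧ IsDeltaHyperbolic (SimpleGraph.mulCayley A).Realization δ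

/-- No element other than the identity has finite order. -/
def IsTorsionFreeGroup (G : Type*) [Group G] : Prop :=
  ∀ g : G, g ≠ 1 → ¬ IsOfFinOrder g

/-- Every injective endomorphism is an automorphism. -/
def IsCoHopfian (G : Type*) [Group G] : Prop :=
  ∀ ψ : G →* G, Function.Injective ψ → Function.Bijective ψ

/-- The geodesic metric `d_A` on `G`: the distance in the Cayley graph. -/
noncomputable def wordDist (A : Set G) (g h : G) : ℝ :=
  ((SimpleGraph.mulCayley A).dist g h : ℝ)

/-- The Gromov product `(g|h)_p` with respect to `d_A`. -/
noncomputable def gromovProduct (A : Set G) (p g h : G) : ℝ :=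
  (wordDist A p g + wordDist A p h - wordDist A g h) / 2

/-- The metric carried by `G` belongs to `V^A(p, γ, T)`. -/
def IsVisualMetric [MetricSpace G] (A : Set G) (p : G) (γ T : ℝ) : Prop :=
  ∀ g h : G, g ≠ h →
    1 / T * Real.exp (-γ * gromovProduct A p g h) ≤ dist g h ∧
    dist g h ≤ T * Real.exp (-γ * gromovProduct A p g h)

end Groups

/-- `f` satisfies a Hölder condition (of some exponent `r > 0`, with some constant `K > 0`). -/
def SatisfiesHolder {X Y : Type*} [MetricSpace X] [MetricSpace Y] (f : X → Y) : Prop :=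
  ∃ K r : ℝ≥0, 0 < K ∧ 0 < r ∧ HolderWith K r f

/-- `f` is a quasi-isometric embedding for the distance functions `d` and `d'`. -/
def IsQuasiIsometricEmbedding {X Y : Type*} (d : X → X → ℝ) (d' : Y → Y → ℝ) (f : X → Y) : Prop :=
  ∃ c K : ℝ, 1 ≤ c ∧ 0 ≤ K ∧ ∀ x y, 1 / c * d x y - K ≤ d' (f x) (f y) ∧
    d' (f x) (f y) ≤ c * d x y + K

/-! The implications form the cycle 1 → 7 → 8 → 5 → 2 → 4 → 3 → 1, together with 8 → 6 → 7.

For 1 → 7, fix `u` with `φ u ≠ 1`. Far from `p`, the points `g` and `g * u` have a large Gromov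
product and are therefore close for the visual metric, while for `g` in the kernel their images stay
at the fixed positive distance from `1` to `φ u`. So the kernel lies in a ball, which is finite. A
finite subgroup of a torsion-free group is trivial, and co-hopficity gives 8. The step 5 → 2 is the
visual inequality with exponents rescaled. Hölder maps extend to completions by density. The
completion is compact, because balls of the word metric are finite nets, so Heine–Cantor gives 3 →
1.

The substantial step is 8 → 5, the only one that uses hyperbolicity: an automorphism coarsely
preserves Gromov products. Here three graphs live on the vertex set `G`: the hyperbolic Cayley
graph, that of `A`, and the latter pulled back along `φ`. They are pairwise bilipschitz. A Morse
lemma (`HasThinTriangles.exists_onGeodesic_near`) makes the geodesics of the first graph follow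
those of the other two. Hence a coarse center of a triangle `p, g, h` in the first graph is one in
all three, and its distance to `p` estimates every Gromov product
(`HasThinTriangles.exists_gromovProduct_le`). -/

namespace SimpleGraph

/-! ### Discrete geodesics in a graph. -/

variable {V : Type*} {Γ : SimpleGraph V}

/-- `v` lies on some geodesic from `x` to `y`. -/
def OnGeodesic (Γ : SimpleGraph V) (x v y : V) : Prop :=
  Γ.dist x v + Γ.dist v y = Γ.dist x y

/-- The Rips condition for the vertices of a graph. -/
def HasThinTriangles (Γ : SimpleGraph V) (D : ℕ) : Prop :=
  ∀ x y z v, Γ.OnGeodesic x v z →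
    ∃ w, Γ.dist v w ≤ D ∧ (Γ.OnGeodesic x w y ∨ Γ.OnGeodesic y w z)

lemma OnGeodesic.symm {x v y : V} (h : Γ.OnGeodesic x v y) : Γ.OnGeodesic y v x := by
  unfold OnGeodesic at *
  rw [Γ.dist_comm (u := y) (v := v), Γ.dist_comm (u := v) (v := x), Γ.dist_comm (u := y) (v := x)]
  omega

lemma onGeodesic_left (x y : V) : Γ.OnGeodesic x x y := by simp [OnGeodesic]

lemma onGeodesic_right (x y : V) : Γ.OnGeodesic x y y := by simp [OnGeodesic]

/-- Geodesics are encoded as sequences on all of `ℕ`, constant after the endpoint; this is why a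
step may be an equality and no index bound is carried along. -/
lemma exists_geodesic_through (hΓ : Γ.Connected) {x v y : V} (h : Γ.OnGeodesic x v y) :
    ∃ f : ℕ → V, f 0 = x ∧ f (Γ.dist x v) = v ∧ f (Γ.dist x y) = y ∧
      ∀ i, f i = f (i + 1) ∨ Γ.Adj (f i) (f (i + 1)) := by
  obtain ⟨w₁, h₁⟩ := hΓ.exists_walk_length_eq_dist x v
  obtain ⟨w₂, h₂⟩ := hΓ.exists_walk_length_eq_dist v y
  refine ⟨(w₁.append w₂).getVert, by simp, ?_, ?_, fun i => ?_⟩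
  · rw [← h₁, Walk.getVert_append]
    simp
  · rw [← h, ← h₁, ← h₂, ← Walk.length_append, Walk.getVert_length]
  · rcases lt_or_ge i (w₁.append w₂).length with hi | hi
    · exact Or.inr (Walk.adj_getVert_succ _ hi)
    · left
      rw [Walk.getVert_of_length_le _ hi, Walk.getVert_of_length_le _ (by omega)]

lemma dist_le_of_steps (hΓ : Γ.Connected) {L : ℕ} {f : ℕ → V}
    (hf : ∀ i, Γ.dist (f i) (f (i + 1)) ≤ L) (i k : ℕ) : Γ.dist (f i) (f (i + k)) ≤ L * k := by
  induction k with
  | zero => simp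
  | succ k ih =>
    have := hΓ.dist_triangle (u := f i) (v := f (i + k)) (w := f (i + (k + 1)))
    have := hf (i + k)
    rw [mul_add, mul_one]
    simp only [add_assoc] at *
    omega

lemma dist_le_one_of_step {x y : V} (h : x = y ∨ Γ.Adj x y) : Γ.dist x y ≤ 1 := by
  rcases h with rfl | h
  · simp
  · rw [dist_eq_one_iff_adj.2 h]

/-- The three pieces cut out by `i` and `j` are at most as long as their index ranges, and these add
up to the full distance, so no piece can be shorter. -/
lemma dist_eq_sub_of_geodesic (hΓ : Γ.Connected) {x y : V} {f : ℕ → V} (h0 : f 0 = x)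
    (hn : f (Γ.dist x y) = y) (hf : ∀ i, f i = f (i + 1) ∨ Γ.Adj (f i) (f (i + 1)))
    {i j : ℕ} (hij : i ≤ j) (hj : j ≤ Γ.dist x y) : Γ.dist (f i) (f j) = j - i := by
  have key : ∀ a b, a ≤ b → Γ.dist (f a) (f b) ≤ b - a := by
    intro a b hab
    have := dist_le_of_steps hΓ (L := 1) (fun i => dist_le_one_of_step (hf i)) a (b - a)
    rwa [Nat.add_sub_cancel' hab, one_mul] at this
  have h1 := key 0 i (Nat.zero_le _)
  have h2 := key i j hij
  have h3 := key j _ hj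
  rw [h0] at h1
  rw [hn] at h3
  have h4 := hΓ.dist_triangle (u := x) (v := f i) (w := y)
  have h5 := hΓ.dist_triangle (u := f i) (v := f j) (w := y)
  omega

lemma onGeodesic_of_geodesic (hΓ : Γ.Connected) {x y : V} {f : ℕ → V} (h0 : f 0 = x)
    (hn : f (Γ.dist x y) = y) (hf : ∀ i, f i = f (i + 1) ∨ Γ.Adj (f i) (f (i + 1)))
    {i : ℕ} (hi : i ≤ Γ.dist x y) : Γ.OnGeodesic x (f i) y := by
  have h1 := dist_eq_sub_of_geodesic hΓ h0 hn hf (Nat.zero_le i) hi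
  have h2 := dist_eq_sub_of_geodesic hΓ h0 hn hf hi le_rfl
  rw [h0] at h1
  rw [hn] at h2
  unfold OnGeodesic
  omega

lemma exists_onGeodesic_dist_eq (hΓ : Γ.Connected) (x y : V) {k : ℕ} (hk : k ≤ Γ.dist x y) :
    ∃ v, Γ.OnGeodesic x v y ∧ Γ.dist x v = k := by
  obtain ⟨f, h0, -, hn, hf⟩ := exists_geodesic_through hΓ (onGeodesic_left (Γ := Γ) x y)
  refine ⟨f k, onGeodesic_of_geodesic hΓ h0 hn hf hk, ?_⟩
  have := dist_eq_sub_of_geodesic hΓ h0 hn hf (Nat.zero_le k) hk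
  rwa [h0, Nat.sub_zero] at this

lemma OnGeodesic.trans_left (hΓ : Γ.Connected) {x u v y : V} (h : Γ.OnGeodesic x v y)
    (hu : Γ.OnGeodesic x u v) : Γ.OnGeodesic x u y ∧ Γ.OnGeodesic u v y := by
  unfold OnGeodesic at *
  have h1 := hΓ.dist_triangle (u := x) (v := u) (w := y)
  have h2 := hΓ.dist_triangle (u := u) (v := v) (w := y)
  omega

/-! ### From geodesics of the realization to geodesics through vertices. -/

namespace Realization

/-- The point dividing the edge from `x` to `y` in the ratio `t : 1 - t`. -/
noncomputable def edgePoint {x y : V} (h : x = y ∨ Γ.Adj x y) (t : ℝ) (h0 : 0 ≤ t) (h1 : t ≤ 1) :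
    Γ.Realization where
  coord := Finsupp.single x (1 - t) + Finsupp.single y t
  nonneg z := by
    classical
    rw [Finsupp.add_apply, Finsupp.single_apply, Finsupp.single_apply]
    split_ifs <;> linarith
  sum_eq := by
    rw [Finsupp.sum_add_index' (fun _ => rfl) (fun _ _ _ => rfl),
      Finsupp.sum_single_index rfl, Finsupp.sum_single_index rfl]
    ring
  edge := ⟨x, y, h, by
    classical
    intro z hz
    rcases Finset.mem_union.1 (Finsupp.support_add hz) with hz | hz
    · exact Or.inl (by simpa using Finsupp.support_single_subset hz)
    · exact Or.inr (by simpa using Finsupp.support_single_subset hz)⟩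

lemma edgePoint_zero {x y : V} (h : x = y ∨ Γ.Adj x y) :
    edgePoint h 0 le_rfl zero_le_one = vertex Γ x := by
  ext1; simp [edgePoint, vertex]

lemma edgePoint_one {x y : V} (h : x = y ∨ Γ.Adj x y) :
    edgePoint h 1 zero_le_one le_rfl = vertex Γ y := by
  ext1; simp [edgePoint, vertex]

lemma edgePoint_self {x : V} (h : x = x ∨ Γ.Adj x x) {t : ℝ} (h0 : 0 ≤ t) (h1 : t ≤ 1) :
    edgePoint h t h0 h1 = vertex Γ x := by
  ext1
  simp only [edgePoint, vertex, ← Finsupp.single_add, sub_add_cancel]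

lemma edgePoint_support {x y : V} (h : x = y ∨ Γ.Adj x y) {t : ℝ} (h0 : 0 ≤ t) (h1 : t ≤ 1) :
    ((edgePoint h t h0 h1).coord.support : Set V) ⊆ {x, y} := by
  classical
  intro z hz
  rcases Finset.mem_union.1 (Finsupp.support_add hz) with hz | hz
  · exact Or.inl (by simpa using Finsupp.support_single_subset hz)
  · exact Or.inr (by simpa using Finsupp.support_single_subset hz)

lemma pathDist_edgePoint_le {x y : V} (h : x = y ∨ Γ.Adj x y) {s t : ℝ} (hs0 : 0 ≤ s)
    (hs1 : s ≤ 1) (ht0 : 0 ≤ t) (ht1 : t ≤ 1) :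
    pathDist (edgePoint h s hs0 hs1) (edgePoint h t ht0 ht1) ≤ |s - t| := by
  by_cases hxy : x = y
  · subst hxy
    rw [edgePoint_self, edgePoint_self, pathDist_self]
    exact abs_nonneg _
  · refine pathDist_le (Or.inl ⟨x, y, h.resolve_left hxy, edgePoint_support ..,
      edgePoint_support .., ?_⟩)
    have : ∀ r h0 h1, (edgePoint h r h0 h1).coord x = 1 - r := by
      intro r h0 h1
      simp [edgePoint, Finsupp.single_eq_of_ne hxy]
    rw [this, this, abs_sub_comm]
    congr 1
    ring

/-- The curve in the realization running at unit speed through the vertices `f 0, f 1, …`. -/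
noncomputable def curve {f : ℕ → V} (hf : ∀ i, f i = f (i + 1) ∨ Γ.Adj (f i) (f (i + 1))) (t : ℝ) :
    Γ.Realization :=
  edgePoint (hf ⌊t⌋₊) (Int.fract t) (Int.fract_nonneg t) (Int.fract_lt_one t).le

variable {f : ℕ → V} (hf : ∀ i, f i = f (i + 1) ∨ Γ.Adj (f i) (f (i + 1)))

lemma curve_natCast (n : ℕ) : curve hf n = vertex Γ (f n) := by
  -- The floor occurs in the type of the edge proof, so it is generalized to a variable before being
  -- replaced.
  have : ∀ (m : ℕ) (t : ℝ) h0 h1, m = n → t = 0 →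
      edgePoint (hf m) t h0 h1 = vertex Γ (f n) := by
    rintro m t h0 h1 rfl rfl
    exact edgePoint_zero _
  exact this _ _ _ _ (by simp) (by simp)

lemma pathDist_curve_vertex_floor (t : ℝ) :
    pathDist (curve hf t) (vertex Γ (f ⌊t⌋₊)) ≤ Int.fract t := by
  rw [← edgePoint_zero (hf ⌊t⌋₊)]
  refine (pathDist_edgePoint_le ..).trans ?_
  rw [sub_zero, abs_of_nonneg (Int.fract_nonneg t)]

lemma pathDist_curve_vertex_floor_succ (t : ℝ) :
    pathDist (curve hf t) (vertex Γ (f (⌊t⌋₊ + 1))) ≤ 1 - Int.fract t := by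
  rw [← edgePoint_one (hf ⌊t⌋₊)]
  refine (pathDist_edgePoint_le ..).trans ?_
  rw [abs_sub_comm, abs_of_nonneg (by linarith [Int.fract_lt_one t])]

lemma pathDist_triangle (hΓ : Γ.Connected) (p q s : Γ.Realization) :
    pathDist p s ≤ pathDist p q + pathDist q s :=
  (metricSpace hΓ).dist_triangle p q s

lemma fract_eq_sub_natFloor {t : ℝ} (ht : 0 ≤ t) : Int.fract t = t - ⌊t⌋₊ := by
  rw [Int.fract, natCast_floor_eq_intCast_floor ht]

/-- Either both parameters lie on one edge, or the path passes through the vertex following `s` and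
the vertex preceding `t`. -/
lemma pathDist_curve_le (hΓ : Γ.Connected) {s t : ℝ} (hs : 0 ≤ s) (hst : s ≤ t) :
    pathDist (curve hf s) (curve hf t) ≤ t - s := by
  have ht := hs.trans hst
  rcases (Nat.floor_mono hst).eq_or_lt with h | h
  · have key : ∀ (m : ℕ), m = ⌊s⌋₊ → ∀ (r : ℝ) h0 h1,
        pathDist (curve hf s) (edgePoint (hf m) r h0 h1) ≤ |Int.fract s - r| := by
      rintro m rfl r h0 h1
      exact pathDist_edgePoint_le ..
    refine (key _ h.symm _ _ _).trans (le_of_eq ?_)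
    rw [fract_eq_sub_natFloor hs, fract_eq_sub_natFloor ht, h, abs_sub_comm,
      abs_of_nonneg (by linarith)]
    ring
  · have h1 := pathDist_curve_vertex_floor_succ hf s
    have h2 := pathDist_curve_vertex_floor hf t
    have h3 := dist_le_of_steps hΓ (L := 1) (fun i => dist_le_one_of_step (hf i)) (⌊s⌋₊ + 1)
      (⌊t⌋₊ - (⌊s⌋₊ + 1))
    rw [Nat.add_sub_cancel' h, one_mul] at h3
    have h4 : (Γ.dist (f (⌊s⌋₊ + 1)) (f ⌊t⌋₊) : ℝ) ≤ ⌊t⌋₊ - (⌊s⌋₊ + 1) := by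
      have h5 : ((⌊t⌋₊ - (⌊s⌋₊ + 1) : ℕ) : ℝ) = ⌊t⌋₊ - (⌊s⌋₊ + 1) := by
        rw [Nat.cast_sub h]
        push_cast
        ring
      rw [← h5]
      exact_mod_cast h3
    rw [← pathDist_vertex] at h4
    rw [pathDist_comm] at h2
    have h6 := pathDist_triangle hΓ (curve hf s) (vertex Γ (f (⌊s⌋₊ + 1))) (curve hf t)
    have h7 := pathDist_triangle hΓ (vertex Γ (f (⌊s⌋₊ + 1))) (vertex Γ (f ⌊t⌋₊)) (curve hf t)
    rw [fract_eq_sub_natFloor hs] at h1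
    rw [fract_eq_sub_natFloor ht] at h2
    linarith

/-- A 1-Lipschitz curve whose endpoints are as far apart as its parameter interval is long must be
isometric. -/
lemma isGeodesicSegment_curve (hΓ : Γ.Connected) {x y : V} (h0 : f 0 = x)
    (hn : f (Γ.dist x y) = y) :
    @IsGeodesicSegment _ (metricSpace hΓ) (vertex Γ x) (vertex Γ y)
      (curve hf '' Set.Icc 0 (Γ.dist x y : ℝ)) := by
  let := metricSpace hΓ
  have c0 : curve hf 0 = vertex Γ x := by simpa [h0] using curve_natCast hf 0
  have cn : curve hf (Γ.dist x y : ℝ) = vertex Γ y := by rw [curve_natCast, hn]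
  have key : ∀ u v, 0 ≤ u → u ≤ v → v ≤ (Γ.dist x y : ℝ) →
      pathDist (curve hf u) (curve hf v) = v - u := by
    intro u v hu huv hv
    refine le_antisymm (pathDist_curve_le hf hΓ hu huv) ?_
    have h1 := pathDist_curve_le hf hΓ le_rfl hu
    have h2 := pathDist_curve_le hf hΓ (hu.trans huv) hv
    rw [c0] at h1
    rw [cn] at h2
    have h3 := pathDist_triangle hΓ (vertex Γ x) (curve hf u) (vertex Γ y)
    have h4 := pathDist_triangle hΓ (curve hf u) (curve hf v) (vertex Γ y)
    rw [pathDist_vertex] at h3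
    linarith
  refine ⟨Γ.dist x y, curve hf, Nat.cast_nonneg _, c0, cn, fun u hu v hv => ?_, rfl⟩
  rcases le_total u v with huv | huv
  · rw [abs_sub_comm, abs_of_nonneg (by linarith)]
    exact key u v hu.1 huv hv.2
  · rw [abs_of_nonneg (by linarith), _root_.dist_comm]
    exact key v u hv.1 huv hu.2

lemma exists_onGeodesic_near_curve (hΓ : Γ.Connected) {x y : V} (h0 : f 0 = x)
    (hn : f (Γ.dist x y) = y) {q : Γ.Realization}
    (hq : q ∈ curve hf '' Set.Icc 0 (Γ.dist x y : ℝ)) :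
    ∃ w, Γ.OnGeodesic x w y ∧ pathDist q (vertex Γ w) ≤ 1 := by
  obtain ⟨t, ht, rfl⟩ := hq
  refine ⟨f ⌊t⌋₊, onGeodesic_of_geodesic hΓ h0 hn hf ?_,
    (pathDist_curve_vertex_floor hf t).trans (Int.fract_lt_one t).le⟩
  exact_mod_cast (Nat.floor_le ht.1).trans ht.2

end Realization

-- The Rips condition is applied to edge curves, the long side being chosen through `v`. Of the
-- extra 2, one unit pays for the infimum distance possibly not being attained, the other for moving
-- the nearby point to a vertex.
open Realization in
lemma hasThinTriangles_of_isDeltaHyperbolic (hΓ : Γ.Connected) {δ : ℝ}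
    (h : @IsDeltaHyperbolic Γ.Realization (metricSpace hΓ) δ) :
    Γ.HasThinTriangles (⌈δ⌉₊ + 2) := by
  intro x y z v hv
  let := metricSpace hΓ
  obtain ⟨f, hf0, hfv, hfn, hf⟩ := exists_geodesic_through hΓ hv
  obtain ⟨f₁, hf₁0, -, hf₁n, hf₁⟩ := exists_geodesic_through hΓ (onGeodesic_left (Γ := Γ) x y)
  obtain ⟨f₂, hf₂0, -, hf₂n, hf₂⟩ := exists_geodesic_through hΓ (onGeodesic_left (Γ := Γ) y z)
  have hmem : vertex Γ v ∈ curve hf '' Set.Icc 0 (Γ.dist x z : ℝ) := by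
    refine ⟨(Γ.dist x v : ℝ), ⟨Nat.cast_nonneg _, ?_⟩, by rw [curve_natCast, hfv]⟩
    have : Γ.dist x v ≤ Γ.dist x z := by unfold OnGeodesic at hv; omega
    exact_mod_cast this
  have s₁ := isGeodesicSegment_curve hf₁ hΓ hf₁0 hf₁n
  have hle := h _ _ _ _ _ _ s₁ (isGeodesicSegment_curve hf₂ hΓ hf₂0 hf₂n)
    (isGeodesicSegment_curve hf hΓ hf0 hfn) _ hmem
  have hne : (curve hf₁ '' Set.Icc 0 (Γ.dist x y : ℝ) ∪
      curve hf₂ '' Set.Icc 0 (Γ.dist y z : ℝ)).Nonempty :=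
    ⟨_, Or.inl ⟨0, ⟨le_rfl, Nat.cast_nonneg _⟩, rfl⟩⟩
  obtain ⟨q, hq, hvq⟩ := (Metric.infDist_lt_iff hne).1 (hle.trans_lt (lt_add_one δ))
  have hvq' : pathDist (vertex Γ v) q < δ + 1 := hvq
  have fin : ∀ w, pathDist q (vertex Γ w) ≤ 1 → Γ.dist v w ≤ ⌈δ⌉₊ + 2 := by
    intro w hw
    have h1 := pathDist_triangle hΓ (vertex Γ v) q (vertex Γ w)
    rw [pathDist_vertex] at h1
    have h2 := Nat.le_ceil δ
    have h3 : (Γ.dist v w : ℝ) ≤ (⌈δ⌉₊ : ℝ) + 2 := by linarith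
    exact_mod_cast h3
  rcases hq with hq | hq
  · obtain ⟨w, hw, hd⟩ := exists_onGeodesic_near_curve hf₁ hΓ hf₁0 hf₁n hq
    exact ⟨w, fin w hd, Or.inl hw⟩
  · obtain ⟨w, hw, hd⟩ := exists_onGeodesic_near_curve hf₂ hΓ hf₂0 hf₂n hq
    exact ⟨w, fin w hd, Or.inr hw⟩

end SimpleGraph

/-! ### Stability of geodesics and of Gromov products under bilipschitz changes of the graph. -/

namespace SimpleGraph

variable {V : Type*} {Γ Γ₁ Γ₂ : SimpleGraph V}

/-- Geodesics stay logarithmically close to paths with the same endpoints. -/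
lemma HasThinTriangles.exists_near_path {D : ℕ} (hD : Γ.HasThinTriangles D) (hΓ : Γ.Connected)
    {L : ℕ} {f : ℕ → V} (hf : ∀ i, Γ.dist (f i) (f (i + 1)) ≤ L) (k : ℕ) :
    ∀ i j, i ≤ j → j ≤ i + 2 ^ k → ∀ v, Γ.OnGeodesic (f i) v (f j) →
      ∃ m, m ≤ j ∧ Γ.dist v (f m) ≤ D * k + L := by
  induction k with
  | zero =>
    intro i j hij hj v hv
    have h1 := dist_le_of_steps hΓ hf i (j - i)
    rw [Nat.add_sub_cancel' hij] at h1
    have h2 : L * (j - i) ≤ L * 1 := Nat.mul_le_mul_left _ (by omega)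
    refine ⟨i, hij, ?_⟩
    rw [Γ.dist_comm]
    unfold OnGeodesic at hv
    omega
  | succ k ih =>
    intro i j hij hj v hv
    -- Bisection: the thin triangle on `f i`, `f l`, `f j` costs one `D`, and both halves have at
    -- most `2 ^ k` steps.
    obtain ⟨l, hil, hlj, h1, h2⟩ : ∃ l, i ≤ l ∧ l ≤ j ∧ l ≤ i + 2 ^ k ∧ j ≤ l + 2 ^ k := by
      rw [pow_succ] at hj
      exact ⟨min j (i + 2 ^ k), by omega, by omega, by omega, by omega⟩
    obtain ⟨w, hvw, hw⟩ := hD _ (f l) _ _ hv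
    have : ∃ m, m ≤ j ∧ Γ.dist w (f m) ≤ D * k + L := by
      rcases hw with hw | hw
      · obtain ⟨m, hm, h⟩ := ih i l hil h1 w hw
        exact ⟨m, hm.trans hlj, h⟩
      · exact ih l j hlj h2 w hw
    obtain ⟨m, hm, h⟩ := this
    refine ⟨m, hm, ?_⟩
    have := hΓ.dist_triangle (u := v) (v := w) (w := f m)
    rw [mul_add, mul_one]
    omega

/-- A linear quantity bounded by its own logarithm is bounded: if the logarithm is `k + 1`, then `2
^ k < c * M ≤ c * (a + D * (k + 1))`, which fails for large `k`. -/
lemma exists_bound_of_le_clog (a D c : ℕ) :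
    ∃ R, ∀ M, M ≤ a + D * Nat.clog 2 (c * M) → M ≤ R := by
  have hlim : Filter.Tendsto (fun n : ℕ => ((n : ℝ) ^ 1 / 2 ^ n)) Filter.atTop (nhds 0) :=
    tendsto_pow_const_div_const_pow_of_one_lt 1 (by norm_num)
  have hlim' : Filter.Tendsto (fun n : ℕ => ((n : ℝ) ^ 0 / 2 ^ n)) Filter.atTop (nhds 0) :=
    tendsto_pow_const_div_const_pow_of_one_lt 0 (by norm_num)
  have h := (hlim'.const_mul ((c * (a + D) : ℕ) : ℝ)).add (hlim.const_mul ((c * D : ℕ) : ℝ))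
  rw [mul_zero, mul_zero, add_zero] at h
  obtain ⟨k₀, hk₀⟩ := Filter.eventually_atTop.1 (h.eventually_lt_const one_pos)
  have hk : ∀ k ≥ k₀, c * (a + D * (k + 1)) < 2 ^ k := by
    intro k hk
    have h1 := hk₀ k hk
    have h2 : (0 : ℝ) < 2 ^ k := by positivity
    rw [pow_zero, pow_one, ← mul_div_assoc, ← mul_div_assoc, ← add_div, div_lt_one h2] at h1
    have h3 : c * (a + D) * 1 + c * D * k < 2 ^ k := by exact_mod_cast h1
    calc c * (a + D * (k + 1)) = c * (a + D) * 1 + c * D * k := by ring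
      _ < _ := h3
  refine ⟨a + D * k₀, fun M hM => ?_⟩
  have hle : Nat.clog 2 (c * M) ≤ k₀ := by
    by_contra! hlt
    obtain ⟨k, hk'⟩ : ∃ k, Nat.clog 2 (c * M) = k + 1 := ⟨Nat.clog 2 (c * M) - 1, by omega⟩
    have h1 : 2 ^ k < c * M := (Nat.lt_clog_iff_pow_lt (by norm_num)).1 (by omega)
    rw [hk'] at hM
    have h2 := hk k (by omega)
    have h3 := Nat.mul_le_mul_left c hM
    omega
  exact hM.trans (by gcongr)

/-- If geodesic triangles of `Γ` are thin and `Γ₁` is bilipschitz equivalent to `Γ`, then geodesics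
of `Γ` stay uniformly close to the geodesics of `Γ₁` with the same endpoints. -/
lemma HasThinTriangles.exists_onGeodesic_near {D : ℕ} (hD : Γ.HasThinTriangles D)
    (hΓ : Γ.Connected) (hΓ₁ : Γ₁.Connected) {c : ℕ}
    (h₁ : ∀ x y, Γ.dist x y ≤ c * Γ₁.dist x y) (h₂ : ∀ x y, Γ₁.dist x y ≤ c * Γ.dist x y) :
    ∃ R, ∀ x y v, Γ.OnGeodesic x v y → ∃ w, Γ₁.OnGeodesic x w y ∧ Γ.dist v w ≤ R := by
  classical
  obtain ⟨R, hR⟩ := exists_bound_of_le_clog (2 * D + c) D (c * 6)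
  refine ⟨R, fun x y v hv => ?_⟩
  obtain ⟨f, hf0, -, hfn, hf⟩ := exists_geodesic_through hΓ₁ (onGeodesic_left (Γ := Γ₁) x y)
  set n := Γ₁.dist x y with hn
  have hstep : ∀ i, Γ.dist (f i) (f (i + 1)) ≤ c := fun i =>
    (h₁ _ _).trans (by simpa using Nat.mul_le_mul_left c (dist_le_one_of_step (hf i)))
  have hex : ∃ M, ∀ u, Γ.OnGeodesic x u y → ∃ m ≤ n, Γ.dist u (f m) ≤ M := by
    refine ⟨Γ.dist x y, fun u hu => ⟨0, Nat.zero_le _, ?_⟩⟩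
    rw [hf0, Γ.dist_comm]
    unfold OnGeodesic at hu
    omega
  -- `M` is the least radius within which the `Γ`-geodesics from `x` to `y` stay near the path `f`.
  -- By minimality some vertex `v₀` on such a geodesic is at distance at least `M` from `f`; it
  -- remains to bound `M`.
  obtain ⟨M, hM, hmin⟩ : ∃ M, (∀ u, Γ.OnGeodesic x u y → ∃ m ≤ n, Γ.dist u (f m) ≤ M) ∧
      ∀ N < M, ¬ ∀ u, Γ.OnGeodesic x u y → ∃ m ≤ n, Γ.dist u (f m) ≤ N :=
    ⟨Nat.find hex, Nat.find_spec hex, fun N hN => Nat.find_min hex hN⟩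
  suffices hMR : M ≤ R by
    obtain ⟨m, hm, h⟩ := hM v hv
    exact ⟨f m, onGeodesic_of_geodesic hΓ₁ hf0 hfn hf hm, h.trans hMR⟩
  rcases Nat.eq_zero_or_pos M with rfl | hpos
  · exact Nat.zero_le _
  have hfar := hmin (M - 1) (by omega)
  push Not at hfar
  obtain ⟨v₀, hv₀, hfar⟩ := hfar
  replace hfar : ∀ m ≤ n, M ≤ Γ.dist v₀ (f m) := fun m hm => by have := hfar m hm; omega
  -- From `v₀` go back `2 * M` towards an endpoint of `f`, stopping there if it comes sooner, then
  -- move to `f` by at most `M`. The connecting geodesic avoids the open `M`-ball around `v₀`.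
  have claim : ∀ e ≤ n, (∀ u, Γ.OnGeodesic (f e) u v₀ → ∃ m ≤ n, Γ.dist u (f m) ≤ M) →
      ∃ u, ∃ i ≤ n, Γ.OnGeodesic (f e) u v₀ ∧ Γ.dist u v₀ ≤ 2 * M ∧ Γ.dist u (f i) ≤ M ∧
        ∀ w, Γ.OnGeodesic u w (f i) → M ≤ Γ.dist v₀ w := by
    intro e he hnear
    by_cases ha : Γ.dist (f e) v₀ < 2 * M
    · refine ⟨f e, e, he, onGeodesic_left _ _, ha.le, by simp, fun w hw => ?_⟩
      have h1 : Γ.dist (f e) w = 0 := by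
        unfold OnGeodesic at hw
        rw [dist_self] at hw
        omega
      rw [← hΓ.dist_eq_zero_iff.1 h1]
      exact hfar e he
    · obtain ⟨u, hu, hud⟩ := exists_onGeodesic_dist_eq hΓ (f e) v₀
        (Nat.sub_le (Γ.dist (f e) v₀) (2 * M))
      obtain ⟨i, hi, hui⟩ := hnear u hu
      have hu' := hu
      unfold OnGeodesic at hu'
      refine ⟨u, i, hi, hu, by omega, hui, fun w hw => ?_⟩
      have h1 := hΓ.dist_triangle (u := u) (v := w) (w := v₀)
      rw [Γ.dist_comm (u := w)] at h1
      unfold OnGeodesic at hw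
      omega
  obtain ⟨u, i, hi, hu, hu2, hui, huw⟩ := claim 0 (Nat.zero_le _) fun u hu =>
    hM u (hv₀.trans_left hΓ (by rwa [hf0] at hu)).1
  obtain ⟨u', j, hj, hu', hu2', huj, huw'⟩ := claim n le_rfl fun u hu =>
    hM u (hv₀.symm.trans_left hΓ (by rwa [hfn] at hu)).1.symm
  rw [hf0] at hu
  rw [hfn] at hu'
  have hgeo : Γ.OnGeodesic u v₀ u' :=
    ((hv₀.trans_left hΓ hu).2.symm.trans_left hΓ hu').2.symm
  apply hR
  -- The quadrilateral `u, f i, f j, u'` is cut into two thin triangles. If `v₀` is close to one of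
  -- the sides joining `u` or `u'` to `f`, then `M ≤ 2 * D`. Otherwise it is close to a geodesic
  -- from `f i` to `f j`, where the logarithmic estimate applies.
  obtain ⟨w₁, hw₁, h | h⟩ := hD u (f i) u' v₀ hgeo
  · have := huw w₁ h
    omega
  obtain ⟨w₂, hw₂, h' | h'⟩ := hD (f i) (f j) u' w₁ h
  -- The route through `u`, `v₀`, `u'` has length at most `M + 2M + 2M + M`; this bounds the number
  -- of steps of `f` between `i` and `j`.
  · have hd₁ : Γ.dist (f i) (f j) ≤ 6 * M := by
      have h3 := hΓ.dist_triangle (u := f i) (v := u) (w := f j)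
      have h4 := hΓ.dist_triangle (u := u) (v := v₀) (w := f j)
      have h5 := hΓ.dist_triangle (u := v₀) (v := u') (w := f j)
      rw [Γ.dist_comm (u := f i) (v := u)] at h3
      rw [Γ.dist_comm (u := v₀) (v := u')] at h5
      omega
    have hd₂ : Γ₁.dist (f i) (f j) ≤ c * 6 * M := by
      rw [mul_assoc]
      exact (h₂ _ _).trans (Nat.mul_le_mul_left _ hd₁)
    have hd₃ := hd₂.trans (Nat.le_pow_clog (b := 2) (by norm_num) (c * 6 * M))
    obtain ⟨m, hm, h6⟩ : ∃ m ≤ n, Γ.dist w₂ (f m) ≤ D * Nat.clog 2 (c * 6 * M) + c := by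
      rcases le_total i j with hij | hij
      · rw [dist_eq_sub_of_geodesic hΓ₁ hf0 hfn hf hij hj] at hd₃
        obtain ⟨m, hm, h6⟩ := hD.exists_near_path hΓ hstep (Nat.clog 2 (c * 6 * M)) i j hij (by omega) w₂ h'
        exact ⟨m, hm.trans hj, h6⟩
      · rw [Γ₁.dist_comm, dist_eq_sub_of_geodesic hΓ₁ hf0 hfn hf hij hi] at hd₃
        obtain ⟨m, hm, h6⟩ := hD.exists_near_path hΓ hstep (Nat.clog 2 (c * 6 * M)) j i hij (by omega) w₂ h'.symm
        exact ⟨m, hm.trans hi, h6⟩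
    have h7 := hfar m hm
    have h8 := hΓ.dist_triangle (u := v₀) (v := w₁) (w := f m)
    have h9 := hΓ.dist_triangle (u := w₁) (v := w₂) (w := f m)
    omega
  · have h7 := huw' w₂ h'.symm
    have h8 := hΓ.dist_triangle (u := v₀) (v := w₁) (w := w₂)
    omega

/-- Walk from `g` to `h` and stop at the first vertex within `D` of a geodesic from `p` to `h`. Its
predecessor must be close to a geodesic from `p` to `g`, which accounts for the extra 1; at the very
start, `g` itself serves. -/
lemma HasThinTriangles.exists_center {D : ℕ} (hD : Γ.HasThinTriangles D) (hΓ : Γ.Connected)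
    (p g h : V) : ∃ z, Γ.OnGeodesic g z h ∧ (∃ a, Γ.OnGeodesic p a g ∧ Γ.dist z a ≤ D + 1) ∧
      ∃ b, Γ.OnGeodesic p b h ∧ Γ.dist z b ≤ D + 1 := by
  classical
  obtain ⟨f, hf0, -, hfn, hf⟩ := exists_geodesic_through hΓ (onGeodesic_left (Γ := Γ) g h)
  have hex : ∃ i, i ≤ Γ.dist g h ∧ ∃ w, Γ.dist (f i) w ≤ D ∧ Γ.OnGeodesic p w h :=
    ⟨_, le_rfl, h, by simp [hfn], onGeodesic_right _ _⟩
  obtain ⟨hi, b, hib, hb⟩ := Nat.find_spec hex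
  have hmin : ∀ j < Nat.find hex, _ := fun j hj => Nat.find_min hex hj
  generalize Nat.find hex = i at *
  refine ⟨f i, onGeodesic_of_geodesic hΓ hf0 hfn hf hi, ?_, b, hb, by omega⟩
  rcases i with _ | i
  · exact ⟨g, onGeodesic_right _ _, by simp [hf0]⟩
  · obtain ⟨w, hw, h | h⟩ := hD g p h (f i)
      (onGeodesic_of_geodesic hΓ hf0 hfn hf (Nat.le_of_succ_le hi))
    · refine ⟨w, h.symm, ?_⟩
      have h1 := dist_le_one_of_step (hf i)
      have h2 := hΓ.dist_triangle (u := f (i + 1)) (v := f i) (w := w)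
      rw [Γ.dist_comm (u := f (i + 1)) (v := f i)] at h2
      omega
    · exact absurd ⟨Nat.le_of_succ_le hi, w, hw, h⟩ (hmin i (Nat.lt_succ_self i))

/-- Gromov products of two graphs which are bilipschitz equivalent to a hyperbolic graph control
each other. -/
lemma HasThinTriangles.exists_gromovProduct_le {D : ℕ} (hD : Γ.HasThinTriangles D)
    (hΓ : Γ.Connected) (hΓ₁ : Γ₁.Connected) (hΓ₂ : Γ₂.Connected) {c : ℕ}
    (h₁ : ∀ x y, Γ.dist x y ≤ c * Γ₁.dist x y) (h₁' : ∀ x y, Γ₁.dist x y ≤ c * Γ.dist x y)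
    (h₂ : ∀ x y, Γ.dist x y ≤ c * Γ₂.dist x y) (h₂' : ∀ x y, Γ₂.dist x y ≤ c * Γ.dist x y) :
    ∃ Q : ℕ, ∀ p g h, (Γ₁.dist p g + Γ₁.dist p h - Γ₁.dist g h : ℤ) ≤
      (c * c : ℕ) * (Γ₂.dist p g + Γ₂.dist p h - Γ₂.dist g h : ℤ) + Q := by
  have near : ∀ Γ' : SimpleGraph V, Γ'.Connected → (∀ x y, Γ.dist x y ≤ c * Γ'.dist x y) →
      (∀ x y, Γ'.dist x y ≤ c * Γ.dist x y) → ∃ C : ℕ, ∀ x y z v, Γ.OnGeodesic x v y →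
        Γ.dist z v ≤ D + 1 → ∃ w, Γ'.OnGeodesic x w y ∧ Γ'.dist z w ≤ C := by
    intro Γ' hΓ' h h'
    obtain ⟨R, hR⟩ := hD.exists_onGeodesic_near hΓ hΓ' h h'
    refine ⟨c * (D + 1 + R), fun x y z v hv hz => ?_⟩
    obtain ⟨w, hw, hvw⟩ := hR x y v hv
    refine ⟨w, hw, (h' _ _).trans (Nat.mul_le_mul_left _ ?_)⟩
    have := hΓ.dist_triangle (u := z) (v := v) (w := w)
    omega
  obtain ⟨C₁, hC₁⟩ := near Γ₁ hΓ₁ h₁ h₁'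
  obtain ⟨C₂, hC₂⟩ := near Γ₂ hΓ₂ h₂ h₂'
  refine ⟨c * c * (4 * C₂) + 2 * C₁, fun p g h => ?_⟩
  -- For a center `z`, closeness to the side `g, h` bounds the doubled `Γ₁`-product above by `2 *
  -- Γ₁.dist p z`, and closeness to the sides from `p` bounds the doubled `Γ₂`-product below by `2 *
  -- Γ₂.dist p z`, up to constants. Passing between the two distances through `Γ` costs `c * c`.
  obtain ⟨z, hz, ⟨a, ha, hza⟩, b, hb, hzb⟩ := hD.exists_center hΓ p g h
  obtain ⟨w, hw, hzw⟩ := hC₁ g h z z hz (by simp)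
  obtain ⟨a', ha', hza'⟩ := hC₂ p g z a ha hza
  obtain ⟨b', hb', hzb'⟩ := hC₂ p h z b hb hzb
  have hp : Γ₁.dist p z ≤ c * c * Γ₂.dist p z := by
    rw [mul_assoc]
    exact (h₁' _ _).trans (Nat.mul_le_mul_left _ (h₂ _ _))
  have upper : (Γ₁.dist p g + Γ₁.dist p h - Γ₁.dist g h : ℤ) ≤ 2 * Γ₁.dist p z + 2 * C₁ := by
    unfold OnGeodesic at hw
    have t1 := hΓ₁.dist_triangle (u := p) (v := z) (w := g)
    have t2 := hΓ₁.dist_triangle (u := z) (v := w) (w := g)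
    have t3 := hΓ₁.dist_triangle (u := p) (v := z) (w := h)
    have t4 := hΓ₁.dist_triangle (u := z) (v := w) (w := h)
    rw [Γ₁.dist_comm (u := w) (v := g)] at t2
    omega
  have lower : 2 * (Γ₂.dist p z : ℤ) ≤
      (Γ₂.dist p g + Γ₂.dist p h - Γ₂.dist g h : ℤ) + 4 * C₂ := by
    unfold OnGeodesic at ha' hb'
    have t1 := hΓ₂.dist_triangle (u := p) (v := a') (w := z)
    have t2 := hΓ₂.dist_triangle (u := z) (v := a') (w := g)
    have t3 := hΓ₂.dist_triangle (u := p) (v := b') (w := z)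
    have t4 := hΓ₂.dist_triangle (u := z) (v := b') (w := h)
    have t5 := hΓ₂.dist_triangle (u := g) (v := z) (w := h)
    rw [Γ₂.dist_comm (u := a') (v := z)] at t1
    rw [Γ₂.dist_comm (u := b') (v := z)] at t3
    rw [Γ₂.dist_comm (u := g) (v := z)] at t5
    omega
  have h5 := mul_le_mul_of_nonneg_left lower (Nat.cast_nonneg (α := ℤ) (c * c))
  have h6 : (Γ₁.dist p z : ℤ) ≤ (c * c : ℕ) * Γ₂.dist p z := by exact_mod_cast hp
  push_cast at *
  linarith

end SimpleGraph

/-! ### Word metrics and homomorphisms. -/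

namespace SimpleGraph

variable {V W : Type*} {Γ : SimpleGraph V} {Γ' : SimpleGraph W}

lemma dist_map_le_of_adj (hΓ : Γ.Connected) (hΓ' : Γ'.Connected) {F : V → W} {c : ℕ}
    (hF : ∀ x y, Γ.Adj x y → Γ'.dist (F x) (F y) ≤ c) (x y : V) :
    Γ'.dist (F x) (F y) ≤ c * Γ.dist x y := by
  obtain ⟨f, h0, -, hn, hf⟩ := exists_geodesic_through hΓ (onGeodesic_left (Γ := Γ) x y)
  have := dist_le_of_steps hΓ' (L := c) (f := F ∘ f) (fun i => by
    rcases hf i with h | h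
    · simp [← h]
    · exact hF _ _ h) 0 (Γ.dist x y)
  simpa [h0, hn] using this

lemma dist_map_le_of_hom (hΓ : Γ.Connected) (hΓ' : Γ'.Connected) (F : Γ →g Γ') (x y : V) :
    Γ'.dist (F x) (F y) ≤ Γ.dist x y := by
  simpa using dist_map_le_of_adj hΓ hΓ' (F := F) (c := 1)
    (fun x y h => (dist_eq_one_iff_adj.2 (F.map_adj h)).le) x y

lemma dist_map_iso (hΓ : Γ.Connected) (hΓ' : Γ'.Connected) (F : Γ ≃g Γ') (x y : V) :
    Γ'.dist (F x) (F y) = Γ.dist x y :=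
  le_antisymm (dist_map_le_of_hom hΓ hΓ' F.toHom x y)
    (by simpa using dist_map_le_of_hom hΓ' hΓ F.symm.toHom (F x) (F y))

end SimpleGraph

section WordMetric

variable {G H : Type*} [Group G] [Group H] {A : Set G} {B : Set H}

lemma mulCayley_dist_mul_left (hA : Subgroup.closure A = ⊤) (k g h : G) :
    (SimpleGraph.mulCayley A).dist (k * g) (k * h) = (SimpleGraph.mulCayley A).dist g h := by
  have hc := mulCayley_connected hA
  have key : ∀ k g h : G, (SimpleGraph.mulCayley A).dist (k * g) (k * h) ≤
      (SimpleGraph.mulCayley A).dist g h := fun k =>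
    SimpleGraph.dist_map_le_of_hom hc hc
      ⟨fun x => k * x, fun h => SimpleGraph.mulCayley_adj_mul_iff_right.2 h⟩
  refine le_antisymm (key k g h) ?_
  simpa using key k⁻¹ (k * g) (k * h)

/-- A homomorphism between finitely generated groups is Lipschitz for the word metrics. -/
lemma exists_mulCayley_dist_map_le (hAfin : A.Finite) (hA : Subgroup.closure A = ⊤)
    (hB : Subgroup.closure B = ⊤) (φ : G →* H) :
    ∃ c : ℕ, ∀ g h, (SimpleGraph.mulCayley B).dist (φ g) (φ h) ≤
      c * (SimpleGraph.mulCayley A).dist g h := by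
  obtain ⟨c, hc⟩ := (hAfin.image fun a => (SimpleGraph.mulCayley B).dist 1 (φ a)).bddAbove
  have hle : ∀ x y, x⁻¹ * y ∈ A → (SimpleGraph.mulCayley B).dist (φ x) (φ y) ≤ c := by
    intro x y h
    rw [← mulCayley_dist_mul_left hB (φ x)⁻¹, inv_mul_cancel, ← map_inv, ← map_mul]
    exact hc ⟨_, h, rfl⟩
  refine ⟨c, SimpleGraph.dist_map_le_of_adj (mulCayley_connected hA) (mulCayley_connected hB) ?_⟩
  intro x y hxy
  rcases ((SimpleGraph.mulCayley_adj A x y).1 hxy).2 with h | h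
  · exact hle x y h
  · rw [SimpleGraph.dist_comm]
    exact hle y x h

lemma finite_mulCayley_ball (hAfin : A.Finite) (hA : Subgroup.closure A = ⊤) (p : G) (n : ℕ) :
    {g | (SimpleGraph.mulCayley A).dist p g ≤ n}.Finite := by
  have hc := mulCayley_connected hA
  induction n with
  | zero =>
    refine (Set.finite_singleton p).subset fun g hg => ?_
    exact (hc.dist_eq_zero_iff.1 (Nat.le_zero.1 hg)).symm
  | succ n ih =>
    have hS : (A ∪ A⁻¹).Finite := hAfin.union hAfin.inv
    refine (ih.union (ih.image2 (fun g a => g * a) hS)).subset fun g hg => ?_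
    by_cases hgn : (SimpleGraph.mulCayley A).dist p g ≤ n
    · exact Or.inl hgn
    · right
      have hg' : (SimpleGraph.mulCayley A).dist p g = n + 1 := by
        have : (SimpleGraph.mulCayley A).dist p g ≤ n + 1 := hg
        omega
      obtain ⟨v, hv, hvn⟩ := SimpleGraph.exists_onGeodesic_dist_eq hc p g (k := n) (by omega)
      unfold SimpleGraph.OnGeodesic at hv
      have hadj : (SimpleGraph.mulCayley A).Adj v g :=
        SimpleGraph.dist_eq_one_iff_adj.1 (by omega)
      refine ⟨v, hvn.le, v⁻¹ * g, ?_, by simp⟩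
      rcases ((SimpleGraph.mulCayley_adj A v g).1 hadj).2 with h | h
      · exact Or.inl h
      · exact Or.inr (by simpa using h)

lemma wordDist_nonneg (g h : G) : 0 ≤ wordDist A g h := Nat.cast_nonneg _

lemma wordDist_comm (g h : G) : wordDist A g h = wordDist A h g := by
  unfold wordDist
  rw [SimpleGraph.dist_comm]

lemma wordDist_triangle (hA : Subgroup.closure A = ⊤) (g h k : G) :
    wordDist A g k ≤ wordDist A g h + wordDist A h k := by
  unfold wordDist
  exact_mod_cast (mulCayley_connected hA).dist_triangle

lemma wordDist_mul_right (hA : Subgroup.closure A = ⊤) (g u : G) :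
    wordDist A g (g * u) = wordDist A 1 u := by
  unfold wordDist
  rw [← mulCayley_dist_mul_left hA g 1 u, mul_one]

lemma finite_wordDist_ball (hAfin : A.Finite) (hA : Subgroup.closure A = ⊤) (p : G) (r : ℝ) :
    {g | wordDist A p g ≤ r}.Finite :=
  (finite_mulCayley_ball hAfin hA p ⌊r⌋₊).subset fun _ hg => Nat.le_floor hg

lemma exists_wordDist_map_le (hAfin : A.Finite) (hA : Subgroup.closure A = ⊤)
    (hB : Subgroup.closure B = ⊤) (φ : G →* H) :
    ∃ c : ℝ, 1 ≤ c ∧ ∀ g h, wordDist B (φ g) (φ h) ≤ c * wordDist A g h := by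
  obtain ⟨c, hc⟩ := exists_mulCayley_dist_map_le hAfin hA hB φ
  refine ⟨c + 1, by simp, fun g h => ?_⟩
  have h1 : wordDist B (φ g) (φ h) ≤ c * wordDist A g h := by
    unfold wordDist
    exact_mod_cast hc g h
  have := wordDist_nonneg (A := A) g h
  linarith

/-- Automorphisms of finitely generated groups are quasi-isometries. -/
lemma isQuasiIsometricEmbedding_of_bijective (hAfin : A.Finite) (hA : Subgroup.closure A = ⊤)
    {φ : G →* G} (hφ : Function.Bijective φ) :
    IsQuasiIsometricEmbedding (wordDist A) (wordDist A) φ := by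
  let e := MulEquiv.ofBijective φ hφ
  obtain ⟨c, hc1, hc⟩ := exists_wordDist_map_le hAfin hA hA φ
  obtain ⟨c', hc1', hc'⟩ := exists_wordDist_map_le hAfin hA hA e.symm.toMonoidHom
  have hinv : ∀ x, e.symm.toMonoidHom (φ x) = x := e.symm_apply_apply
  refine ⟨max c c', 0, le_max_of_le_left hc1, le_rfl, fun x y => ⟨?_, ?_⟩⟩
  · rw [sub_zero, one_div, inv_mul_le_iff₀ (by positivity)]
    have h1 := hc' (φ x) (φ y)
    rw [hinv, hinv] at h1
    exact h1.trans (mul_le_mul_of_nonneg_right (le_max_right _ _) (wordDist_nonneg _ _))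
  · rw [add_zero]
    exact (hc x y).trans (mul_le_mul_of_nonneg_right (le_max_left _ _) (wordDist_nonneg _ _))

/-- The lower bound confines elements with the same image as `1` to a ball of radius `c * K`. -/
lemma IsQuasiIsometricEmbedding.finite_ker (hAfin : A.Finite) (hA : Subgroup.closure A = ⊤)
    {φ : G →* H} (hφ : IsQuasiIsometricEmbedding (wordDist A) (wordDist B) φ) :
    (φ.ker : Set G).Finite := by
  obtain ⟨c, K, hc, -, h⟩ := hφ
  refine (finite_wordDist_ball hAfin hA 1 (c * K)).subset fun g hg => ?_
  have h1 := (h 1 g).1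
  rw [map_one, MonoidHom.mem_ker.1 hg] at h1
  have h2 : wordDist B (1 : H) 1 = 0 := by simp [wordDist]
  rw [h2, sub_nonpos, one_div, inv_mul_le_iff₀ (by positivity)] at h1
  exact h1

/-- Automorphisms of hyperbolic groups coarsely preserve Gromov products. -/
lemma IsHyperbolicGroup.exists_gromovProduct_le (hG : IsHyperbolicGroup G) (hAfin : A.Finite)
    (hA : Subgroup.closure A = ⊤) (p : G) {φ : G →* G} (hφ : Function.Bijective φ) :
    ∃ P Q : ℝ, 0 < P ∧ ∀ g h : G,
      gromovProduct A p g h ≤ P * gromovProduct A p (φ g) (φ h) + Q := by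
  obtain ⟨A₀, hA₀fin, hA₀, δ, -, hδ⟩ := hG
  let e := MulEquiv.ofBijective φ hφ
  have hc₀ := mulCayley_connected hA₀
  have hc := mulCayley_connected hA
  have hD := SimpleGraph.hasThinTriangles_of_isDeltaHyperbolic hc₀ hδ
  -- Pulling the Cayley graph of `A` back along `φ` turns the products of images into products of a
  -- third graph on `G`.
  let F := SimpleGraph.Iso.comap e.toEquiv (SimpleGraph.mulCayley A)
  have hc₂ := F.connected_iff.2 hc
  have hF : ∀ x y, ((SimpleGraph.mulCayley A).comap e.toEquiv).dist x y =
      (SimpleGraph.mulCayley A).dist (φ x) (φ y) := fun x y =>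
    (SimpleGraph.dist_map_iso hc₂ hc F x y).symm
  obtain ⟨a, ha⟩ := exists_mulCayley_dist_map_le hAfin hA hA₀ (MonoidHom.id G)
  obtain ⟨a', ha'⟩ := exists_mulCayley_dist_map_le hA₀fin hA₀ hA (MonoidHom.id G)
  obtain ⟨b, hb⟩ := exists_mulCayley_dist_map_le hAfin hA hA₀ e.symm.toMonoidHom
  obtain ⟨b', hb'⟩ := exists_mulCayley_dist_map_le hA₀fin hA₀ hA φ
  have hinv : ∀ x, e.symm.toMonoidHom (φ x) = x := e.symm_apply_apply
  let c := a + a' + b + b' + 1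
  have weaken : ∀ m n k : ℕ, k ≤ c → m ≤ k * n → m ≤ c * n := fun m n k hk h =>
    h.trans (Nat.mul_le_mul_right _ hk)
  obtain ⟨Q, hQ⟩ := hD.exists_gromovProduct_le hc₀ hc hc₂ (c := c)
    (fun x y => weaken _ _ a (by omega) (ha x y)) (fun x y => weaken _ _ a' (by omega) (ha' x y))
    (fun x y => weaken _ _ b (by omega) (by
      have := hb (φ x) (φ y)
      rwa [hinv, hinv, ← hF] at this))
    (fun x y => weaken _ _ b' (by omega) (by rw [hF]; exact hb' x y))
  have hP : (0 : ℝ) < (c * c : ℕ) := by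
    have : 0 < c * c := Nat.mul_pos (Nat.succ_pos _) (Nat.succ_pos _)
    exact_mod_cast this
  -- The pulled-back product is based at `φ p`; returning to `p` changes it by at most `wordDist A p
  -- (φ p)`. The half comes from working with doubled products.
  refine ⟨(c * c : ℕ), (c * c : ℕ) * wordDist A p (φ p) + Q / 2, hP, fun g h => ?_⟩
  have h1 := hQ p g h
  rw [hF, hF, hF] at h1
  have h2 : wordDist A p g + wordDist A p h - wordDist A g h ≤ (c * c : ℕ) *
      (wordDist A (φ p) (φ g) + wordDist A (φ p) (φ h) - wordDist A (φ g) (φ h)) + Q := by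
    unfold wordDist
    exact_mod_cast h1
  have h3 := wordDist_triangle hA (φ p) p (φ g)
  have h4 := wordDist_triangle hA (φ p) p (φ h)
  rw [wordDist_comm (φ p) p] at h3 h4
  have h5 := mul_le_mul_of_nonneg_left (add_le_add h3 h4) hP.le
  unfold gromovProduct
  linarith

lemma sub_le_gromovProduct (hA : Subgroup.closure A = ⊤) (p g h : G) :
    wordDist A p g - wordDist A g h ≤ gromovProduct A p g h := by
  have := wordDist_triangle hA p h g
  rw [wordDist_comm h g] at this
  unfold gromovProduct
  linarith

end WordMetric

/-! ### Visual metrics. -/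

section VisualMetric

variable {G : Type*} [Group G] {A : Set G} {p : G} {γ T : ℝ} [MetricSpace G]

lemma IsVisualMetric.dist_le (hd : IsVisualMetric A p γ T) (hT : 0 ≤ T) (g h : G) :
    dist g h ≤ T * Real.exp (-γ * gromovProduct A p g h) := by
  by_cases hgh : g = h
  · rw [hgh, dist_self]
    positivity
  · exact (hd g h hgh).2

lemma IsVisualMetric.exists_dist_lt (hd : IsVisualMetric A p γ T) (hγ : 0 < γ) (hT : 1 ≤ T)
    {ε : ℝ} (hε : 0 < ε) :
    ∃ N : ℝ, ∀ g h : G, N ≤ gromovProduct A p g h → dist g h < ε := by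
  have hT0 : 0 < T := by linarith
  -- Solving `T * exp (-γ * N) = ε` for `N`, with 1 added to the numerator to make the inequality
  -- strict.
  refine ⟨(1 - Real.log (ε / T)) / γ, fun g h hN => (hd.dist_le hT0.le g h).trans_lt ?_⟩
  rw [div_le_iff₀ hγ] at hN
  have h1 : Real.exp (-γ * gromovProduct A p g h) < ε / T := by
    rw [← Real.lt_log_iff_exp_lt (by positivity)]
    linarith
  rwa [lt_div_iff₀ hT0, mul_comm] at h1

/-- A large finite ball around `p` is an ε-net: a point `g` outside it is approximated by the vertex
`v` where a geodesic from `p` to `g` leaves the ball, since the Gromov product of `g` and `v` equals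
`wordDist A p v`. -/
lemma IsVisualMetric.totallyBounded_univ (hd : IsVisualMetric A p γ T) (hγ : 0 < γ) (hT : 1 ≤ T)
    (hAfin : A.Finite) (hA : Subgroup.closure A = ⊤) : TotallyBounded (Set.univ : Set G) := by
  refine Metric.totallyBounded_iff.2 fun ε hε => ?_
  obtain ⟨N, hN⟩ := hd.exists_dist_lt hγ hT hε
  refine ⟨_, finite_mulCayley_ball hAfin hA p ⌈N⌉₊, fun g _ => ?_⟩
  simp only [Set.mem_iUnion, Metric.mem_ball]
  rcases le_total ((SimpleGraph.mulCayley A).dist p g) ⌈N⌉₊ with h | h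
  · exact ⟨g, h, by simpa using hε⟩
  · obtain ⟨v, hv, hvN⟩ :=
      SimpleGraph.exists_onGeodesic_dist_eq (mulCayley_connected hA) p g h
    refine ⟨v, hvN.le, hN _ _ ?_⟩
    have h1 : wordDist A p v + wordDist A v g = wordDist A p g := by
      unfold wordDist
      exact_mod_cast hv
    have h2 : wordDist A p v = ⌈N⌉₊ := by
      unfold wordDist
      rw [hvN]
    have h3 := Nat.le_ceil N
    unfold gromovProduct
    rw [wordDist_comm g v]
    linarith

/-- Right translation by a fixed `u` moves far away points very little in the visual metric, but for
`g` in the kernel the images of `g` and `g * u` are `1` and `φ u`. -/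
lemma IsVisualMetric.finite_ker_of_uniformContinuous (hd : IsVisualMetric A p γ T) (hγ : 0 < γ)
    (hT : 1 ≤ T) (hAfin : A.Finite) (hA : Subgroup.closure A = ⊤) {φ : G →* G}
    (hφ : ∃ g, φ g ≠ 1) (huc : UniformContinuous φ) : (φ.ker : Set G).Finite := by
  obtain ⟨u, hu⟩ := hφ
  obtain ⟨ε, hε, huc⟩ := Metric.uniformContinuous_iff.1 huc _ (dist_pos.2 hu)
  obtain ⟨N, hN⟩ := hd.exists_dist_lt hγ hT hε
  refine (finite_wordDist_ball hAfin hA p (N + wordDist A 1 u)).subset fun g hg => ?_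
  by_contra hlt
  rw [Set.mem_ofPred_eq, not_le] at hlt
  have h1 := sub_le_gromovProduct hA p g (g * u)
  rw [wordDist_mul_right hA] at h1
  have h2 := huc (hN g (g * u) (by linarith))
  rw [map_mul, MonoidHom.mem_ker.1 hg, one_mul, dist_comm] at h2
  exact lt_irrefl _ h2

lemma IsVisualMetric.satisfiesHolder (hd : IsVisualMetric A p γ T) (hγ : 0 < γ) (hT : 1 ≤ T)
    {f : G → G} {P Q : ℝ} (hP : 0 < P)
    (hf : ∀ g h, gromovProduct A p g h ≤ P * gromovProduct A p (f g) (f h) + Q) :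
    SatisfiesHolder f := by
  have hT0 : 0 < T := by linarith
  -- The exponent is `1 / P`: the hypothesis gives a product of images of at least `((g|h) - Q) /
  -- P`. The factor `T ^ (1 / P)` comes from the lower visual bound for `dist g h`.
  have hK : 0 < T * Real.exp (γ * Q / P) * T ^ (1 / P) := by positivity
  have hr : 0 < 1 / P := by positivity
  obtain ⟨K, hKe⟩ : ∃ K : ℝ≥0, (K : ℝ) = _ := ⟨_, Real.coe_toNNReal _ hK.le⟩
  obtain ⟨r, hre⟩ : ∃ r : ℝ≥0, (r : ℝ) = _ := ⟨_, Real.coe_toNNReal _ hr.le⟩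
  refine ⟨K, r, NNReal.coe_pos.1 (hKe ▸ hK), NNReal.coe_pos.1 (hre ▸ hr), fun g h => ?_⟩
  by_cases hgh : g = h
  · simp [hgh]
  rw [edist_dist, edist_dist, ENNReal.ofReal_rpow_of_nonneg dist_nonneg r.coe_nonneg,
    ← ENNReal.ofReal_coe_nnreal, ← ENNReal.ofReal_mul K.coe_nonneg]
  refine ENNReal.ofReal_le_ofReal ?_
  rw [hKe, hre]
  have h1 : Real.exp (-γ * gromovProduct A p g h) ≤ T * dist g h := by
    have := (hd g h hgh).1
    rwa [one_div, inv_mul_le_iff₀ hT0] at this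
  calc dist (f g) (f h) ≤ T * Real.exp (-γ * gromovProduct A p (f g) (f h)) :=
        hd.dist_le hT0.le _ _
    _ ≤ T * Real.exp (γ * Q / P + -γ * gromovProduct A p g h * (1 / P)) := by
        gcongr
        have h2 := hf g h
        have h3 : γ * Q / P + -γ * gromovProduct A p g h * (1 / P) =
            -(γ * ((gromovProduct A p g h - Q) / P)) := by ring
        have h4 : (gromovProduct A p g h - Q) / P ≤ gromovProduct A p (f g) (f h) := by
          rw [div_le_iff₀ hP]
          linarith
        rw [h3, neg_mul]
        exact neg_le_neg (mul_le_mul_of_nonneg_left h4 hγ.le)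
    _ = T * Real.exp (γ * Q / P) * Real.exp (-γ * gromovProduct A p g h) ^ (1 / P) := by
        rw [Real.exp_add, ← Real.exp_mul, ← mul_assoc T]
    _ ≤ T * Real.exp (γ * Q / P) * (T * dist g h) ^ (1 / P) := by gcongr
    _ = _ := by rw [Real.mul_rpow hT0.le dist_nonneg, mul_assoc, mul_assoc, mul_assoc]

end VisualMetric

/-! ### Extension to the completion. -/

section Completion

open UniformSpace

variable {X Y : Type*} [MetricSpace X] [MetricSpace Y]

lemma SatisfiesHolder.uniformContinuous {f : X → Y} (hf : SatisfiesHolder f) :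
    UniformContinuous f := by
  obtain ⟨K, r, -, hr, h⟩ := hf
  exact h.uniformContinuous hr

/-- The inequality is a closed condition on pairs and holds on a dense set, so exponent and constant
are unchanged. -/
lemma SatisfiesHolder.completion_map {f : X → Y} (hf : SatisfiesHolder f) :
    SatisfiesHolder (Completion.map f) := by
  have huc := hf.uniformContinuous
  obtain ⟨K, r, hK, hr, h⟩ := hf
  refine ⟨K, r, hK, hr, fun x y => ?_⟩
  induction x, y using Completion.induction_on₂ with
  | hp =>
    have hc : Continuous (Completion.map f) := Completion.continuous_map
    refine isClosed_le ((hc.comp continuous_fst).edist (hc.comp continuous_snd)) ?_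
    exact (ENNReal.continuous_const_mul ENNReal.coe_ne_top).comp
      (ENNReal.continuous_rpow_const.comp (continuous_fst.edist continuous_snd))
  | ih x y =>
    rw [Completion.map_coe huc, Completion.map_coe huc, Completion.edist_eq, Completion.edist_eq]
    exact h x y

/-- The completion of a totally bounded space is compact, so Heine–Cantor applies to `F`; the
uniform structure of `Y` is induced from its completion. -/
lemma uniformContinuous_of_continuous_completion (hX : TotallyBounded (Set.univ : Set X))
    {f : X → Y} {F : Completion X → Completion Y} (hF : ∀ x : X, F x = f x)
    (hc : Continuous F) : UniformContinuous f := by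
  have hcomp : CompactSpace (Completion X) := by
    refine isCompact_univ_iff.1 (isCompact_iff_totallyBounded_isComplete.2
      ⟨?_, isComplete_univ⟩)
    have h1 := (hX.image (Completion.uniformContinuous_coe X)).closure
    rwa [Set.image_univ, Completion.denseRange_coe.closure_range] at h1
  rw [(Completion.isUniformInducing_coe Y).uniformContinuous_iff]
  have h2 := (CompactSpace.uniformContinuous_of_continuous hc).comp
    (Completion.uniformContinuous_coe X)
  rwa [show F ∘ (↑) = (↑) ∘ f from funext hF] at h2

end Completion

/-! ### Torsion-freeness and the equivalences. -/

lemma IsTorsionFreeGroup.injective_of_finite_ker {G H : Type*} [Group G] [Group H]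
    (hG : IsTorsionFreeGroup G) {φ : G →* H} (hφ : (φ.ker : Set G).Finite) :
    Function.Injective φ := by
  refine (injective_iff_map_eq_one φ).2 fun g hg => ?_
  by_contra hne
  have : Finite φ.ker := hφ.to_subtype
  exact hG g hne (Submonoid.isOfFinOrder_coe.2 (isOfFinOrder_of_finite (⟨g, hg⟩ : φ.ker)))

theorem corollary5p4 {G : Type*} [Group G] (hhyp : IsHyperbolicGroup G)
    (htf : IsTorsionFreeGroup G) (hco : IsCoHopfian G)
    (A : Set G) (hAfin : A.Finite) (hA : Subgroup.closure A = ⊤)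
    (p : G) (γ T : ℝ) (hγ : 0 < γ) (hT : 1 ≤ T)
    [d : MetricSpace G] (hd : IsVisualMetric A p γ T)
    (φ : G →* G) (hφ : ∃ g, φ g ≠ 1) :
    List.TFAE [
      UniformContinuous φ,
      SatisfiesHolder φ,
      ∃ Φ : UniformSpace.Completion G → UniformSpace.Completion G,
        (∀ g : G, Φ (g : UniformSpace.Completion G) = (φ g : UniformSpace.Completion G)) ∧
        Continuous Φ,
      ∃ Φ : UniformSpace.Completion G → UniformSpace.Completion G,
        (∀ g : G, Φ (g : UniformSpace.Completion G) = (φ g : UniformSpace.Completion G)) ∧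
        SatisfiesHolder Φ,
      ∃ P Q : ℝ, 0 < P ∧ ∀ g h : G,
        gromovProduct A p g h ≤ P * gromovProduct A p (φ g) (φ h) + Q,
      IsQuasiIsometricEmbedding (wordDist A) (wordDist A) φ,
      (φ.ker : Set G).Finite,
      Function.Bijective φ] := by
  tfae_have 1 → 7 := hd.finite_ker_of_uniformContinuous hγ hT hAfin hA hφ
  tfae_have 7 → 8 := fun h => hco φ (htf.injective_of_finite_ker h)
  tfae_have 8 → 5 := fun h => hhyp.exists_gromovProduct_le hAfin hA p h
  tfae_have 5 → 2 := fun ⟨P, Q, hP, h⟩ => hd.satisfiesHolder hγ hT hP h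
  tfae_have 2 → 4 := fun h =>
    ⟨UniformSpace.Completion.map φ, fun g => UniformSpace.Completion.map_coe h.uniformContinuous g,
      h.completion_map⟩
  tfae_have 4 → 3 := fun ⟨Φ, hΦ, h⟩ => ⟨Φ, hΦ, h.uniformContinuous.continuous⟩
  tfae_have 3 → 1 := fun ⟨Φ, hΦ, h⟩ => uniformContinuous_of_continuous_completion
    (hd.totallyBounded_univ hγ hT hAfin hA) hΦ h
  tfae_have 8 → 6 := isQuasiIsometricEmbedding_of_bijective hAfin hA
  tfae_have 6 → 7 := fun h => h.finite_ker hAfin hA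
  tfae_finish
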